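/- Let $\mathbb K$ be a field of characteristic $0$. Let $C_k=\{[1],\dots,[k]\}$, and let $\mathbb K[C_k]$ be the vector space with basis $C_k$. For $i,j\ge 1$ and $1\le\lambda\le j$ let $R_0(j;i,\lambda):C_{i+j-1}\to C_j$ send $[r]$ to $[r]$ if $r\le\lambda-1$, to $[\lambda]$ if $\lambda\le r\le\lambda+i-1$, and to $[r-i+1]$ if $r\ge\lambda+i$. Let $R_\lambda(j;i,\lambda):C_{i+j-1}\to\mathbb K[C_i]$ send $[r]$ to $[r-\lambda+1]$ if $\lambda\le r\le\lambda+i-1$ and to $[1]+\cdots+[i]$ otherwise. Families of maps indexed by $C_k$ are extended linearly to $\mathbb K[C_k]$. A dendriform algebra is a vector space $A$ with bilinear maps $\prec,\succ$ such that $(a\prec b)\prec c=a\prec(b\prec c+b\succ c)$, $(a\succ b)\prec c=a\succ(b\prec c)$ and $(a\prec b+a\succ b)\succ c=a\succ(b\succ c)$. Write $\pi([1];a,b)=a\prec b$ and $\pi([2];a,b)=a\succ b$. A representation of $A$ is a vector space $M$ with bilinear maps $\prec,\succ:A\times M\to M$ and $\prec,\succ:M\times A\to M$ satisfying the nine identities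 obtained from these three by letting exactly one of the three arguments lie in $M$. Write $\theta_1([1];a,m)=a\prec m$, $\theta_1([2];a,m)=a\succ m$, $\theta_2([1];m,a)=m\prec a$, $\theta_2([2];m,a)=m\succ a$. A $k$-cochain is a linear map $f:\mathbb K[C_k]\otimes A^{\otimes k}\to M$. It is a $k$-cocycle if, for all $[r]\in C_{k+1}$ and $a_1,\dots,a_{k+1}\in A$, $$\begin{aligned}0={}&\theta_1\big(R_0(2;k,2)[r];\,a_1,\,f(R_2(2;k,2)[r];a_2,\dots,a_{k+1})\big)\\&+\sum_{\lambda=1}^{k}(-1)^\lambda f\big(R_0(k;2,\lambda)[r];\,a_1,\dots,a_{\lambda-1},\,\pi(R_\lambda(k;2,\lambda)[r];a_\lambda,a_{\lambda+1}),\,a_{\lambda+2},\dots,a_{k+1}\big)\\&+(-1)^{k+1}\theta_2\big(R_0(2;k,1)[r];\,f(R_1(2;k,1)[r];a_1,\dots,a_k),\,a_{k+1}\big).\end{aligned}$$ A $\mathrm{Dend}_\infty$-algebra structure on a $\mathbb Z$-graded vector space $V=\bigoplus_d V_d$ is a family of multilinear maps $\mu_{k,[r]}:V^{\otimes k}\to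 V$ ($k\ge1$, $[r]\in C_k$) of degree $k-2$ such that for all $N\ge1$, $[r]\in C_N$ and homogeneous $a_1,\dots,a_N\in V$ $$\sum_{i+j=N+1}\ \sum_{\lambda=1}^{j}(-1)^{\lambda(i+1)+i(|a_1|+\cdots+|a_{\lambda-1}|)}\,\mu_{j,R_0(j;i,\lambda)[r]}\big(a_1,\dots,a_{\lambda-1},\,\mu_{i,R_\lambda(j;i,\lambda)[r]}(a_\lambda,\dots,a_{\lambda+i-1}),\,a_{\lambda+i},\dots,a_N\big)=0.$$ **Theorem.** Let $n\ge 2$. (1) Let $V=\bigoplus_d V_d$ be a graded vector space with $V_d=0$ for $d\ne 0,n-1$. For every $\mathrm{Dend}_\infty$-algebra structure on $V$ with zero differential $\mu_{1,[1]}=0$, the restrictions $$\pi([r];a,b)=\mu_{2,[r]}(a,b),\quad \theta_1([r];a,m)=\mu_{2,[r]}(a,m),\quad \theta_2([r];m,a)=\mu_{2,[r]}(m,a),\quad \sigma([s];a_1,\dots,a_{n+1})=\mu_{n+1,[s]}(a_1,\dots,a_{n+1})$$ ($a,b,a_p\in A:=V_0$, $m\in M:=V_{n-1}$, $[r]\in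 C_2$, $[s]\in C_{n+1}$) make $A$ a dendriform algebra and $(M,\theta_1,\theta_2)$ a representation of it, and $\sigma$ is an $(n+1)$-cocycle of $A$ with coefficients in $M$. This assignment is a bijection from the set of $\mathrm{Dend}_\infty$-algebra structures on $V$ with $\mu_{1,[1]}=0$ onto the set of tuples $(\pi,\theta_1,\theta_2,\sigma)$ consisting of a dendriform algebra structure on $V_0$, a representation of it on $V_{n-1}$ and an $(n+1)$-cocycle with coefficients in this representation. (2) Every tuple $(A,M,\theta_1,\theta_2,\sigma)$ arises in this way: for arbitrary vector spaces $A$ and $M$, $V=A\oplus M$ with $A$ in degree $0$ and $M$ in degree $n-1$ is a graded vector space concentrated in degrees $0$ and $n-1$, and the same assignment is a bijection from the set of $\mathrm{Dend}_\infty$-algebra structures on $V$ with $\mu_{1,[1]}=0$ onto the set of such tuples with underlying spaces $A$ and $M$. -/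

import Mathlib

/-! ### Combinatorial maps

The set `C_k = {[1], …, [k]}` is `Fin k`, the symbol `[r]` being the element of `Fin k` with value
`r - 1`, and the vector space `K[C_k]` is `Fin k → K` with its standard basis. In the same way
inputs and positions are counted from `0`. Throughout, an operation with `i` inputs is inserted
into position `l` of an operation with `j` inputs, giving an operation with `N = i + j - 1` inputs;
this is recorded by `h : i + j = N + 1`. -/

/-- `R_0 (j; 1, …, i, …, 1) : C_{i+j-1} → C_j`, with `i` at position `l`. -/
def dendR0 {i j N : ℕ} (h : i + j = N + 1) (l : Fin j) (r : Fin N) : Fin j :=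
  if h1 : r.val < l.val then ⟨r.val, by omega⟩
  else if h2 : r.val < l.val + i then l
  else ⟨r.val + 1 - i, by omega⟩

/-- `R_l (j; 1, …, i, …, 1) : C_{i+j-1} → K[C_i]`, with `i` at position `l`. -/
def dendR (K : Type*) [Field K] {i j N : ℕ} (_h : i + j = N + 1) (l : Fin j) (r : Fin N) :
    Fin i → K :=
  if h1 : r.val < l.val then fun _ => 1
  else if h2 : r.val < l.val + i then Pi.single ⟨r.val - l.val, by omega⟩ 1
  else fun _ => 1

/-- The linear extension to `K[C_k]` of a family of maps labelled by the elements of `C_k`. -/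
def dendLin {K : Type*} [Field K] {k : ℕ} {E : Type*} [AddCommGroup E] [Module K E]
    (f : Fin k → E) (c : Fin k → K) : E :=
  ∑ r, c r • f r

/-- The inputs `(a_l, …, a_{l+i-1})` of the inner operation. -/
def dendInner {X : Type*} {i j N : ℕ} (h : i + j = N + 1) (l : Fin j) (a : Fin N → X) :
    Fin i → X :=
  fun q => a ⟨l.val + q.val, by omega⟩

/-- The inputs `(a_0, …, a_{l-1}, y, a_{l+i}, …, a_{N-1})` of the outer operation. -/
def dendOuter {X : Type*} {i j N : ℕ} (h : i + j = N + 1) (l : Fin j) (a : Fin N → X) (y : X) :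
    Fin j → X :=
  fun p =>
    if hp : p.val < l.val then a ⟨p.val, by omega⟩
    else if hq : p.val = l.val then y
    else a ⟨p.val + i - 1, by omega⟩

/-! ### Dendriform algebras, representations, cochains -/

/-- A dendriform algebra structure on the vector space `A`. -/
structure DendriformStr (K : Type*) [Field K] (A : Type*) [AddCommGroup A] [Module K A] where
  prec : A →ₗ[K] A →ₗ[K] A
  succ : A →ₗ[K] A →ₗ[K] A
  ax1 : ∀ a b c, prec (prec a b) c = prec a (prec b c + succ b c)
  ax2 : ∀ a b c, prec (succ a b) c = succ a (prec b c)
  ax3 : ∀ a b c, succ (prec a b + succ a b) c = succ a (succ b c)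

/-- The multiplication `π_A`: `π_A([1]; a, b) = a ≺ b` and `π_A([2]; a, b) = a ≻ b`. -/
def DendriformStr.pi {K : Type*} [Field K] {A : Type*} [AddCommGroup A] [Module K A]
    (S : DendriformStr K A) : Fin 2 → (A →ₗ[K] A →ₗ[K] A) :=
  ![S.prec, S.succ]

/-- A representation of the dendriform algebra `(A, S)` on the vector space `M`: two left actions
`lprec`, `lsucc` and two right actions `rprec`, `rsucc` satisfying nine identities. -/
structure DendriformRep {K : Type*} [Field K] {A : Type*} [AddCommGroup A] [Module K A]
    (S : DendriformStr K A) (M : Type*) [AddCommGroup M] [Module K M] where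
  lprec : A →ₗ[K] M →ₗ[K] M
  lsucc : A →ₗ[K] M →ₗ[K] M
  rprec : M →ₗ[K] A →ₗ[K] M
  rsucc : M →ₗ[K] A →ₗ[K] M
  left1 : ∀ a b m, lprec (S.prec a b) m = lprec a (lprec b m + lsucc b m)
  left2 : ∀ a b m, lprec (S.succ a b) m = lsucc a (lprec b m)
  left3 : ∀ a b m, lsucc (S.prec a b + S.succ a b) m = lsucc a (lsucc b m)
  mid1 : ∀ a m c, rprec (lprec a m) c = lprec a (rprec m c + rsucc m c)
  mid2 : ∀ a m c, rprec (lsucc a m) c = lsucc a (rprec m c)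
  mid3 : ∀ a m c, rsucc (lprec a m + lsucc a m) c = lsucc a (rsucc m c)
  right1 : ∀ m b c, rprec (rprec m b) c = rprec m (S.prec b c + S.succ b c)
  right2 : ∀ m b c, rprec (rsucc m b) c = rsucc m (S.prec b c)
  right3 : ∀ m b c, rsucc (rprec m b + rsucc m b) c = rsucc m (S.succ b c)

/-- `θ_1([1]; a, m) = a ≺ m` and `θ_1([2]; a, m) = a ≻ m`. -/
def DendriformRep.theta1 {K : Type*} [Field K] {A : Type*} [AddCommGroup A] [Module K A]
    {S : DendriformStr K A} {M : Type*} [AddCommGroup M] [Module K M] (R : DendriformRep S M) :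
    Fin 2 → (A →ₗ[K] M →ₗ[K] M) :=
  ![R.lprec, R.lsucc]

/-- `θ_2([1]; m, a) = m ≺ a` and `θ_2([2]; m, a) = m ≻ a`. -/
def DendriformRep.theta2 {K : Type*} [Field K] {A : Type*} [AddCommGroup A] [Module K A]
    {S : DendriformStr K A} {M : Type*} [AddCommGroup M] [Module K M] (R : DendriformRep S M) :
    Fin 2 → (M →ₗ[K] A →ₗ[K] M) :=
  ![R.rprec, R.rsucc]

/-- The space `Hom(K[C_k] ⊗ A^{⊗ k}, M)` of `k`-cochains, a linear map being given by its
components `f([r]; -)`, which are multilinear maps. -/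
abbrev DendCochain (K : Type*) [Field K] (A M : Type*) [AddCommGroup A] [Module K A]
    [AddCommGroup M] [Module K M] (k : ℕ) :=
  Fin k → MultilinearMap K (fun _ : Fin k => A) M

/-- The value `(δ f)([r]; a_1, …, a_{k+1})` of the coboundary of the `k`-cochain `f`. -/
def dendDelta {K : Type*} [Field K] {A : Type*} [AddCommGroup A] [Module K A]
    {S : DendriformStr K A} {M : Type*} [AddCommGroup M] [Module K M] (R : DendriformRep S M)
    {k : ℕ} (f : DendCochain K A M k) (r : Fin (k + 1)) (a : Fin (k + 1) → A) : M :=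
  have h1 : k + 2 = (k + 1) + 1 := by omega
  have h2 : 2 + k = (k + 1) + 1 := by omega
  R.theta1 (dendR0 h1 1 r) (a 0) (dendLin f (dendR K h1 1 r) (dendInner h1 1 a))
  + ∑ l : Fin k, (-1 : K) ^ (l.val + 1) •
      f (dendR0 h2 l r)
        (dendOuter h2 l a
          (dendLin S.pi (dendR K h2 l r) (dendInner h2 l a 0) (dendInner h2 l a 1)))
  + (-1 : K) ^ (k + 1) •
      R.theta2 (dendR0 h1 0 r) (dendLin f (dendR K h1 0 r) (dendInner h1 0 a)) (a (Fin.last k))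

/-- `f` is a `k`-cocycle of the dendriform algebra `(A, S)` with coefficients in `(M, R)`. -/
def IsDendCocycle {K : Type*} [Field K] {A : Type*} [AddCommGroup A] [Module K A]
    {S : DendriformStr K A} {M : Type*} [AddCommGroup M] [Module K M] (R : DendriformRep S M)
    {k : ℕ} (f : DendCochain K A M k) : Prop :=
  ∀ (r : Fin (k + 1)) (a : Fin (k + 1) → A), dendDelta R f r a = 0

/-- The tuples `(A, M, θ_1, θ_2, σ)` with underlying vector spaces `A` and `M`: a dendriform
algebra structure on `A`, a representation of it on `M` and an `(n+1)`-cocycle `σ`. -/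
structure DendCocycleTuple (K : Type*) [Field K] (A M : Type*) [AddCommGroup A] [Module K A]
    [AddCommGroup M] [Module K M] (n : ℕ) where
  str : DendriformStr K A
  rep : DendriformRep str M
  sigma : DendCochain K A M (n + 1)
  cocycle : IsDendCocycle rep sigma

/-! ### `Dend_∞`-algebras -/

theorem dendArity {N : ℕ} (s : Fin N) : (s.val + 1) + (N - s.val) = N + 1 := by omega

/-- A `Dend_∞`-algebra structure on the graded vector space `V = ⨁ d, 𝒜 d`: operations
`μ_{k,[r]}` for `k ≥ 1` and `[r] ∈ C_k` (there is no `[r]` for `k = 0`) of degree `k - 2`, with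

`∑_{i+j=N+1} ∑_{λ=1}^{j} (-1)^{λ(i+1) + i(|a_1| + ⋯ + |a_{λ-1}|)}
  μ_{j,R_0[r]}(a_1, …, a_{λ-1}, μ_{i,R_λ[r]}(a_λ, …, a_{λ+i-1}), a_{λ+i}, …, a_N) = 0`

for all homogeneous `a_1, …, a_N`. The summation indices below are `s = i - 1` and `l = λ - 1`. -/
structure DendInfStr {K : Type*} [Field K] {V : Type*} [AddCommGroup V] [Module K V]
    (𝒜 : ℤ → Submodule K V) where
  mu : (k : ℕ) → Fin k → MultilinearMap K (fun _ : Fin k => V) V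
  degree : ∀ (k : ℕ) (r : Fin k) (d : Fin k → ℤ) (a : Fin k → V),
    (∀ p, a p ∈ 𝒜 (d p)) → mu k r a ∈ 𝒜 ((∑ p, d p) + ((k : ℤ) - 2))
  identity : ∀ (N : ℕ) (r : Fin N) (d : Fin N → ℤ) (a : Fin N → V),
    (∀ p, a p ∈ 𝒜 (d p)) →
    (∑ s : Fin N, ∑ l : Fin (N - s.val),
      (-1 : K) ^ (((l.val : ℤ) + 1) * ((s.val : ℤ) + 2)
          + ((s.val : ℤ) + 1) * ∑ p : Fin N, if p.val < l.val then d p else 0) •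
        mu (N - s.val) (dendR0 (dendArity s) l r)
          (dendOuter (dendArity s) l a
            (dendLin (mu (s.val + 1)) (dendR K (dendArity s) l r)
              (dendInner (dendArity s) l a)))) = 0

/-- `V` is concentrated in degrees `0` and `n - 1`. -/
def ConcentratedZeroAnd {K : Type*} [Field K] {V : Type*} [AddCommGroup V] [Module K V]
    (𝒜 : ℤ → Submodule K V) (n : ℕ) : Prop :=
  ∀ d : ℤ, d ≠ 0 → d ≠ (n : ℤ) - 1 → 𝒜 d = ⊥

/-- The `Dend_∞`-algebra structures on `V = ⨁ d, 𝒜 d` with zero differential `μ_1`. -/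
def DendInfZeroDiff {K : Type*} [Field K] {V : Type*} [AddCommGroup V] [Module K V]
    (𝒜 : ℤ → Submodule K V) :=
  {D : DendInfStr 𝒜 // D.mu 1 = 0}

/-- The tuple `T` on `(A, M)` consists of the restrictions of the operations `μ_2` and `μ_{n+1}`
of `D`, when `A` and `M` are viewed in `V` through the maps `u` and `v`. -/
structure DendCorresponds {K : Type*} [Field K] {V : Type*} [AddCommGroup V] [Module K V]
    {𝒜 : ℤ → Submodule K V} {A M : Type*} [AddCommGroup A] [Module K A]
    [AddCommGroup M] [Module K M] {n : ℕ} (u : A →ₗ[K] V) (v : M →ₗ[K] V)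
    (D : DendInfStr 𝒜) (T : DendCocycleTuple K A M n) : Prop where
  pi_eq : ∀ (r : Fin 2) (a b : A), u (T.str.pi r a b) = D.mu 2 r ![u a, u b]
  theta1_eq : ∀ (r : Fin 2) (a : A) (m : M), v (T.rep.theta1 r a m) = D.mu 2 r ![u a, v m]
  theta2_eq : ∀ (r : Fin 2) (m : M) (a : A), v (T.rep.theta2 r m a) = D.mu 2 r ![v m, u a]
  sigma_eq : ∀ (r : Fin (n + 1)) (a : Fin (n + 1) → A),
    v (T.sigma r a) = D.mu (n + 1) r (fun p => u (a p))

/-- The graded vector space `A ⊕ M` with `A` in degree `0` and `M` in degree `n - 1`. -/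
def zeroAndGrading (K : Type*) [Field K] (A M : Type*) [AddCommGroup A] [Module K A]
    [AddCommGroup M] [Module K M] (n : ℕ) (d : ℤ) : Submodule K (A × M) :=
  (if d = 0 then ⊤ else ⊥ : Submodule K A).prod (if d = (n : ℤ) - 1 then ⊤ else ⊥)

/-! Write `A` and `M` for the parts in degrees `0` and `n - 1`. Everything follows from counting
degrees. With `q` inputs from `M`, `μ_k` lands in degree `q(n - 1) + k - 2`, and this must be `0` or
`n - 1`. As `n ≥ 2` and `μ_1 = 0`, the only survivors are `μ_2` on `A ⊗ A`, `A ⊗ M` and `M ⊗ A`, and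
`μ_{n+1}` on `A^{⊗(n+1)}` with values in `M` (`mu_apply_eq_zero`, `mu_two_v_v`). Hence a structure
is determined by its tuple (`eq_of_corresponds`).

In the identity with `N` inputs only arities `i, j ∈ {2, n+1}` matter, so `N` is `3`, `n + 2` or `2n
+ 1`. For `N = 3` the signs do not depend on the degrees, and the identity gives the dendriform
axioms on `A` and, with one input in `M`, the nine representation axioms
(`forall_insert_two_two_eq_zero_iff`). For `N = n + 2` and inputs in `A` it is the cocycle condition
(`insert_add_insert_eq_dendDelta`). In all other cases every term vanishes, because the product of
two elements of `M` is zero and `σ` takes values in `M` but vanishes when an argument is in `M`. So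
extending a tuple by zero gives a structure (`extendMu_identity`).

The argument uses only a `TwoDegreeSplitting`, which covers both the internal grading and the
external sum `A × M`. -/

/-! ### Partial sums of the `Dend_∞` identity -/

section Insert

variable {K : Type*} [Field K] {V : Type*} [AddCommGroup V] [Module K V]

/-- The part of the `Dend_∞` identity in which an operation with `i` inputs is inserted into an
operation with `j` inputs. -/
def dendInfInsert (mu : (k : ℕ) → Fin k → MultilinearMap K (fun _ : Fin k => V) V) {i j N : ℕ}
    (h : i + j = N + 1) (r : Fin N) (d : Fin N → ℤ) (a : Fin N → V) : V :=
  ∑ l : Fin j, (-1 : K) ^ (((l.val : ℤ) + 1) * ((i : ℤ) + 1)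
      + (i : ℤ) * ∑ p : Fin N, if p.val < l.val then d p else 0) •
    mu j (dendR0 h l r) (dendOuter h l a (dendLin (mu i) (dendR K h l r) (dendInner h l a)))

variable (mu : (k : ℕ) → Fin k → MultilinearMap K (fun _ : Fin k => V) V)

theorem dendInfInsert_congr {i j i' j' N : ℕ} (h : i + j = N + 1) (h' : i' + j' = N + 1)
    (hi : i = i') (r : Fin N) (d : Fin N → ℤ) (a : Fin N → V) :
    dendInfInsert mu h r d a = dendInfInsert mu h' r d a := by
  obtain rfl : j = j' := by omega
  subst hi
  rfl

theorem dendInf_sum_eq (N : ℕ) (r : Fin N) (d : Fin N → ℤ) (a : Fin N → V) :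
    (∑ s : Fin N, ∑ l : Fin (N - s.val),
      (-1 : K) ^ (((l.val : ℤ) + 1) * ((s.val : ℤ) + 2)
          + ((s.val : ℤ) + 1) * ∑ p : Fin N, if p.val < l.val then d p else 0) •
        mu (N - s.val) (dendR0 (dendArity s) l r)
          (dendOuter (dendArity s) l a
            (dendLin (mu (s.val + 1)) (dendR K (dendArity s) l r)
              (dendInner (dendArity s) l a)))) =
    ∑ s : Fin N, dendInfInsert mu (dendArity s) r d a := by
  refine Finset.sum_congr rfl fun s _ => Finset.sum_congr rfl fun l _ => ?_
  congr 2

theorem dendOuter_self {X : Type*} {i j N : ℕ} (h : i + j = N + 1) (l : Fin j) (a : Fin N → X)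
    (y : X) : dendOuter h l a y l = y := by
  simp [dendOuter]

theorem dendLin_apply {ι : Type*} {k : ℕ} (f : Fin k → MultilinearMap K (fun _ : ι => V) V)
    (c : Fin k → K) (x : ι → V) : dendLin f c x = ∑ r, c r • f r x := by
  simp [dendLin]

theorem dendInfInsert_eq_zero_of_inner {i j N : ℕ} (h : i + j = N + 1) (hi : mu i = 0)
    (r : Fin N) (d : Fin N → ℤ) (a : Fin N → V) : dendInfInsert mu h r d a = 0 := by
  refine Finset.sum_eq_zero fun l _ => ?_
  rw [MultilinearMap.map_coord_zero _ l, smul_zero]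
  rw [dendOuter_self, dendLin_apply]
  simp [hi]

theorem dendInfInsert_eq_zero_of_outer {i j N : ℕ} (h : i + j = N + 1) (hj : mu j = 0)
    (r : Fin N) (d : Fin N → ℤ) (a : Fin N → V) : dendInfInsert mu h r d a = 0 := by
  refine Finset.sum_eq_zero fun l _ => ?_
  simp [hj]

theorem dendInf_sum_three (h1 : mu 1 = 0) (r : Fin 3) (d : Fin 3 → ℤ) (a : Fin 3 → V) :
    ∑ s : Fin 3, dendInfInsert mu (dendArity s) r d a =
      dendInfInsert mu (i := 2) (j := 2) rfl r d a := by
  refine (Finset.sum_eq_single (1 : Fin 3) ?_ ?_).trans rfl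
  · intro s _ hs
    fin_cases s
    · exact dendInfInsert_eq_zero_of_inner _ _ h1 _ _ _
    · exact absurd rfl hs
    · exact dendInfInsert_eq_zero_of_outer _ _ h1 _ _ _
  · simp

theorem dendInf_sum_add_two {n : ℕ} (hn : 2 ≤ n) (hmu : ∀ k, k ≠ 2 → k ≠ n + 1 → mu k = 0)
    (r : Fin (n + 2)) (d : Fin (n + 2) → ℤ) (a : Fin (n + 2) → V) :
    ∑ s : Fin (n + 2), dendInfInsert mu (dendArity s) r d a =
      dendInfInsert mu (i := 2) (j := n + 1) (by omega) r d a +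
      dendInfInsert mu (i := n + 1) (j := 2) (by omega) r d a := by
  rw [Finset.sum_eq_add (⟨1, by omega⟩ : Fin (n + 2)) ⟨n, by omega⟩]
  · congr 1
    exact dendInfInsert_congr _ _ _ rfl _ _ _
  · simp only [ne_eq, Fin.mk.injEq]
    omega
  · rintro ⟨s, hs⟩ - ⟨hs1, hsn⟩
    simp only [ne_eq, Fin.mk.injEq] at hs1 hsn
    exact dendInfInsert_eq_zero_of_inner _ _ (hmu _ (by simpa using hs1) (by simpa using hsn)) _ _ _
  · simp
  · simp

theorem dendInfInsert_two_two (r : Fin 3) (d : Fin 3 → ℤ) (a : Fin 3 → V) :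
    dendInfInsert mu (i := 2) (j := 2) rfl r d a =
      mu 2 (![0, 1, 1] r) ![a 0, dendLin (mu 2)
        ((![fun _ => 1, Pi.single 0 1, Pi.single 1 1] : Fin 3 → Fin 2 → K) r)
        ![a 1, a 2]] -
      mu 2 (![0, 0, 1] r) ![dendLin (mu 2)
        ((![Pi.single 0 1, Pi.single 1 1, fun _ => 1] : Fin 3 → Fin 2 → K) r)
        ![a 0, a 1], a 2] := by
  -- For inner arity `2` the degrees enter the exponent with an even coefficient, so the signs are
  -- constants.
  have e1 : ∀ z : ℤ, (-1 : K) ^ ((1 : ℤ) * (2 + 1) + 2 * z) = -1 := fun z =>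
    Odd.neg_one_zpow ⟨1 + z, by ring⟩
  have e2 : ∀ z : ℤ, (-1 : K) ^ (((1 : ℤ) + 1) * (2 + 1) + 2 * z) = 1 := fun z =>
    Even.neg_one_zpow ⟨3 + z, by ring⟩
  have o1 : ∀ y, dendOuter (i := 2) (j := 2) (N := 3) rfl 0 a y = ![y, a 2] := fun y => by
    ext p; fin_cases p <;> rfl
  have o2 : ∀ y, dendOuter (i := 2) (j := 2) (N := 3) rfl 1 a y = ![a 0, y] := fun y => by
    ext p; fin_cases p <;> rfl
  have i1 : dendInner (i := 2) (j := 2) (N := 3) rfl 0 a = ![a 0, a 1] := by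
    ext p; fin_cases p <;> rfl
  have i2 : dendInner (i := 2) (j := 2) (N := 3) rfl 1 a = ![a 1, a 2] := by
    ext p; fin_cases p <;> rfl
  rw [dendInfInsert, Fin.sum_univ_two, o1, o2, i1, i2]
  simp only [Fin.val_zero, Fin.val_one, Nat.cast_zero, Nat.cast_one, Nat.cast_ofNat, zero_add,
    e1, e2, one_smul, neg_smul]
  have r1 : dendR0 (i := 2) (j := 2) (N := 3) rfl 0 r = ![0, 0, 1] r := by
    fin_cases r <;> rfl
  have r2 : dendR0 (i := 2) (j := 2) (N := 3) rfl 1 r = ![0, 1, 1] r := by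
    fin_cases r <;> rfl
  have c1 : dendR K (i := 2) (j := 2) (N := 3) rfl 0 r =
      (![Pi.single 0 1, Pi.single 1 1, fun _ => 1] : Fin 3 → Fin 2 → K) r := by
    fin_cases r <;> simp [dendR]
  have c2 : dendR K (i := 2) (j := 2) (N := 3) rfl 1 r =
      (![fun _ => 1, Pi.single 0 1, Pi.single 1 1] : Fin 3 → Fin 2 → K) r := by
    fin_cases r <;> simp [dendR]
  rw [neg_add_eq_sub, r1, r2, c1, c2]

end Insert

/-! ### Splittings of a graded vector space concentrated in two degrees -/

section Linear

variable {K : Type*} [Field K] {k : ℕ} {E F : Type*} [AddCommGroup E] [Module K E]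
  [AddCommGroup F] [Module K F]

theorem dendLin_single (f : Fin k → E) (r : Fin k) : dendLin f (Pi.single r (1 : K)) = f r := by
  simp [dendLin, Pi.single_apply]

theorem dendLin_one_two (f : Fin 2 → E) : dendLin f (fun _ => (1 : K)) = f 0 + f 1 := by
  simp [dendLin]

theorem dendLin_apply₂ {G : Type*} [AddCommGroup G] [Module K G]
    (f : Fin k → (E →ₗ[K] F →ₗ[K] G)) (c : Fin k → K) (x : E) (y : F) :
    dendLin f c x y = ∑ r, c r • f r x y := by
  simp [dendLin]

end Linear

/-- A splitting of a graded vector space concentrated in degrees `0` and `n - 1` into copies of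
`A` (in degree `0`) and `M` (in degree `n - 1`). -/
structure TwoDegreeSplitting {K : Type*} [Field K] {V : Type*} [AddCommGroup V] [Module K V]
    (𝒜 : ℤ → Submodule K V) (A M : Type*) [AddCommGroup A] [Module K A]
    [AddCommGroup M] [Module K M] (n : ℕ) where
  u : A →ₗ[K] V
  v : M →ₗ[K] V
  p : V →ₗ[K] A
  q : V →ₗ[K] M
  p_u : ∀ a, p (u a) = a
  p_v : ∀ m, p (v m) = 0
  q_u : ∀ a, q (u a) = 0
  q_v : ∀ m, q (v m) = m
  decomp : ∀ x, u (p x) + v (q x) = x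
  u_mem : ∀ a, u a ∈ 𝒜 0
  v_mem : ∀ m, v m ∈ 𝒜 ((n : ℤ) - 1)
  q_eq_zero : ∀ x ∈ 𝒜 0, q x = 0
  p_eq_zero : ∀ x ∈ 𝒜 ((n : ℤ) - 1), p x = 0
  concentrated : ConcentratedZeroAnd 𝒜 n

namespace TwoDegreeSplitting

variable {K : Type*} [Field K] {V : Type*} [AddCommGroup V] [Module K V]
  {𝒜 : ℤ → Submodule K V} {A M : Type*} [AddCommGroup A] [Module K A]
  [AddCommGroup M] [Module K M] {n : ℕ} (S : TwoDegreeSplitting 𝒜 A M n)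

theorem u_p {x : V} (hx : S.q x = 0) : S.u (S.p x) = x := by
  simpa [hx] using S.decomp x

theorem v_q {x : V} (hx : S.p x = 0) : S.v (S.q x) = x := by
  simpa [hx] using S.decomp x

theorem u_p_of_mem {x : V} (hx : x ∈ 𝒜 0) : S.u (S.p x) = x := S.u_p (S.q_eq_zero x hx)

theorem v_q_of_mem {x : V} (hx : x ∈ 𝒜 ((n : ℤ) - 1)) : S.v (S.q x) = x :=
  S.v_q (S.p_eq_zero x hx)

theorem u_injective : Function.Injective S.u := Function.LeftInverse.injective S.p_u

theorem v_injective : Function.Injective S.v := Function.LeftInverse.injective S.q_v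

theorem ext_p_q {x y : V} (hp : S.p x = S.p y) (hq : S.q x = S.q y) : x = y := by
  rw [← S.decomp x, ← S.decomp y, hp, hq]

/-- The identity with `n + 2` inputs, on inputs of degree `0`, is the cocycle condition. -/
theorem insert_add_insert_eq_dendDelta
    (mu : (k : ℕ) → Fin k → MultilinearMap K (fun _ : Fin k => V) V)
    {T : DendriformStr K A} (R : DendriformRep T M) (f : DendCochain K A M (n + 1))
    (hpi : ∀ r a b, mu 2 r ![S.u a, S.u b] = S.u (T.pi r a b))
    (h1 : ∀ r a m, mu 2 r ![S.u a, S.v m] = S.v (R.theta1 r a m))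
    (h2 : ∀ r m a, mu 2 r ![S.v m, S.u a] = S.v (R.theta2 r m a))
    (hf : ∀ r a, mu (n + 1) r (fun p => S.u (a p)) = S.v (f r a))
    (r : Fin (n + 2)) (a : Fin (n + 2) → A) :
    dendInfInsert mu (i := 2) (j := n + 1) (by omega) r 0 (fun p => S.u (a p)) +
      dendInfInsert mu (i := n + 1) (j := 2) (by omega) r 0 (fun p => S.u (a p)) =
    S.v (dendDelta R f r a) := by
  have lin2 : ∀ (c : Fin 2 → K) (b : Fin 2 → A),
      dendLin (mu 2) c (fun p => S.u (b p)) = S.u (dendLin T.pi c (b 0) (b 1)) := by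
    intro c b
    have hb : (fun p => S.u (b p)) = ![S.u (b 0), S.u (b 1)] := by
      ext p; fin_cases p <;> rfl
    simp only [dendLin_apply, dendLin_apply₂, hb, hpi, map_sum, map_smul]
  have linf : ∀ (c : Fin (n + 1) → K) (b : Fin (n + 1) → A),
      dendLin (mu (n + 1)) c (fun p => S.u (b p)) = S.v (dendLin f c b) := by
    intro c b
    simp only [dendLin, sum_apply, smul_apply, hf, map_sum, map_smul]
  have outer_u : ∀ (h : 2 + (n + 1) = n + 2 + 1) (l : Fin (n + 1)) (y : A),
      dendOuter h l (fun p => S.u (a p)) (S.u y) = fun p => S.u (dendOuter h l a y p) := by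
    intro h l y
    ext p
    simp only [dendOuter]
    split_ifs <;> rfl
  have o1 : ∀ (h : n + 1 + 2 = n + 2 + 1) (y : V),
      dendOuter h (0 : Fin 2) (fun p => S.u (a p)) y = ![y, S.u (a (Fin.last (n + 1)))] := by
    intro h y
    ext p; fin_cases p
    · rfl
    · simp only [dendOuter]
      simp
      congr 2
  have o2 : ∀ (h : n + 1 + 2 = n + 2 + 1) (y : V),
      dendOuter h (1 : Fin 2) (fun p => S.u (a p)) y = ![S.u (a 0), y] := by
    intro h y
    ext p; fin_cases p <;> rfl
  -- In degree `0` only the positional part of the sign remains: `(-1)^{3λ} = (-1)^λ` for an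
  -- inserted product. For an inserted `σ` the exponent is `n + 2` in the first slot, matching the
  -- `θ_2` term, and even in the second, matching the `θ_1` term.
  have e1 : ∀ l : ℕ, (-1 : K) ^ (((l : ℤ) + 1) * (((2 : ℕ) : ℤ) + 1)) = (-1) ^ (l + 1) := by
    intro l
    rw [show ((l : ℤ) + 1) * (((2 : ℕ) : ℤ) + 1) = ((l + 1 + 2 * (l + 1) : ℕ) : ℤ) by push_cast; ring,
      zpow_natCast, pow_add, pow_mul]
    simp
  have e2 : (-1 : K) ^ ((0 + 1 : ℤ) * (((n + 1 : ℕ) : ℤ) + 1)) = (-1) ^ (n + 1 + 1) := by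
    rw [zero_add, one_mul, ← Nat.cast_succ, zpow_natCast]
  have e3 : (-1 : K) ^ ((1 + 1 : ℤ) * (((n + 1 : ℕ) : ℤ) + 1)) = 1 :=
    Even.neg_one_zpow ⟨((n + 1 : ℕ) : ℤ) + 1, by ring⟩
  have inner : ∀ {i j : ℕ} (h : i + j = n + 2 + 1) (l : Fin j),
      dendInner h l (fun p => S.u (a p)) = fun p => S.u (dendInner h l a p) := fun _ _ => rfl
  simp only [dendInfInsert, dendDelta, Fin.sum_univ_two, Pi.zero_apply, ite_self,
    Finset.sum_const_zero, mul_zero, add_zero, inner, lin2, linf, outer_u, o1, o2, e1, hf, h1, h2,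
    Fin.val_zero, Fin.val_one, Nat.cast_zero, Nat.cast_one, e2, e3, one_smul, map_add, map_smul,
    map_sum]
  abel

end TwoDegreeSplitting

/-! ### Bilinear maps as multilinear maps in two variables -/

section Bilinear

variable {K : Type*} [Field K] {V W : Type*} [AddCommGroup V] [Module K V]
  [AddCommGroup W] [Module K W]

/-- A multilinear map in two variables as a bilinear map. -/
def MultilinearMap.toBilin (f : MultilinearMap K (fun _ : Fin 2 => V) W) : V →ₗ[K] V →ₗ[K] W :=
  LinearMap.mk₂ K (fun x y => f ![x, y])
    (fun x x' y => f.cons_add ![y] x x')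
    (fun c x y => f.cons_smul ![y] c x)
    (fun x y y' => (f.curryLeft x).cons_add ![] y y')
    (fun c x y => (f.curryLeft x).cons_smul ![] c y)

@[simp]
theorem MultilinearMap.toBilin_apply (f : MultilinearMap K (fun _ : Fin 2 => V) W) (x y : V) :
    f.toBilin x y = f ![x, y] := rfl

/-- A bilinear map as a multilinear map in two variables. -/
def LinearMap.toMultilinearTwo (B : V →ₗ[K] V →ₗ[K] W) :
    MultilinearMap K (fun _ : Fin 2 => V) W where
  toFun x := B (x 0) (x 1)
  map_update_add' {inst} m i x y := by
    -- The field quantifies over an arbitrary decidability instance; `simp` evaluates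
    -- `Function.update` with the canonical one.
    rw [Subsingleton.elim inst (instDecidableEqFin 2)]
    fin_cases i <;> simp
  map_update_smul' {inst} m i c x := by
    rw [Subsingleton.elim inst (instDecidableEqFin 2)]
    fin_cases i <;> simp

end Bilinear

/-! ### Extensionality for dendriform structures and representations -/

section Ext

variable {K : Type*} [Field K] {A M : Type*} [AddCommGroup A] [Module K A]
  [AddCommGroup M] [Module K M]

theorem DendriformStr.ext_pi {T T' : DendriformStr K A} (h : T.pi = T'.pi) : T = T' := by
  have h0 := congrFun h 0
  have h1 := congrFun h 1
  cases T; cases T'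
  simp only [DendriformStr.pi, Matrix.cons_val_zero, Matrix.cons_val_one] at h0 h1
  subst h0 h1
  rfl

theorem DendriformRep.ext_theta {T : DendriformStr K A} {R R' : DendriformRep T M}
    (h1 : R.theta1 = R'.theta1) (h2 : R.theta2 = R'.theta2) : R = R' := by
  have h10 := congrFun h1 0
  have h11 := congrFun h1 1
  have h20 := congrFun h2 0
  have h21 := congrFun h2 1
  cases R; cases R'
  simp only [DendriformRep.theta1, DendriformRep.theta2, Matrix.cons_val_zero,
    Matrix.cons_val_one] at h10 h11 h20 h21
  subst h10 h11 h20 h21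
  rfl

end Ext

/-! ### Degree constraints and uniqueness -/

namespace TwoDegreeSplitting

variable {K : Type*} [Field K] {V : Type*} [AddCommGroup V] [Module K V]
  {𝒜 : ℤ → Submodule K V} {A M : Type*} [AddCommGroup A] [Module K A]
  [AddCommGroup M] [Module K M] {n : ℕ} (S : TwoDegreeSplitting 𝒜 A M n)

include S

theorem eq_zero_of_mem {e : ℤ} {x : V} (hx : x ∈ 𝒜 e) (h0 : e ≠ 0) (h1 : e ≠ (n : ℤ) - 1) :
    x = 0 := by
  rwa [S.concentrated e h0 h1, Submodule.mem_bot] at hx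

/-- Multilinear maps agreeing on homogeneous elements are equal. -/
theorem multilinear_ext {k : ℕ} {f g : MultilinearMap K (fun _ : Fin k => V) V}
    (h : ∀ (d : Fin k → ℤ) (a : Fin k → V), (∀ p, d p = 0 ∨ d p = (n : ℤ) - 1) →
      (∀ p, a p ∈ 𝒜 (d p)) → f a = g a) : f = g := by
  ext x
  have hx : x = (fun p => S.u (S.p (x p))) + fun p => S.v (S.q (x p)) :=
    funext fun p => (S.decomp (x p)).symm
  -- Expanding each input into its two components gives a sum over the set `s` of slots filled from
  -- degree `0`; each summand has homogeneous inputs.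
  rw [hx, f.map_add_univ, g.map_add_univ]
  refine Finset.sum_congr rfl fun s _ => ?_
  refine h (s.piecewise (fun _ => 0) fun _ => (n : ℤ) - 1) _ (fun p => ?_) fun p => ?_
  · by_cases hp : p ∈ s <;> simp [hp]
  · by_cases hp : p ∈ s <;> simp [hp, S.u_mem, S.v_mem]

/-- An input of nonzero degree pushes the output degree to at least `(n - 1) + (k - 2) > n - 1`.
Without one it equals `k - 2 > 0`, which is `n - 1` only for `k = n + 1`. -/
theorem mu_apply_eq_zero (hn : 2 ≤ n) (D : DendInfStr 𝒜) {k : ℕ} (hk : 3 ≤ k) (r : Fin k)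
    (d : Fin k → ℤ) (a : Fin k → V) (hd : ∀ p, d p = 0 ∨ d p = (n : ℤ) - 1)
    (ha : ∀ p, a p ∈ 𝒜 (d p)) (h : (∃ p, d p ≠ 0) ∨ k ≠ n + 1) : D.mu k r a = 0 := by
  have hd0 : ∀ p, 0 ≤ d p := fun p => by have := hd p; omega
  have hsum : 0 ≤ ∑ p, d p := Finset.sum_nonneg fun p _ => hd0 p
  by_cases hex : ∃ p, d p ≠ 0
  · obtain ⟨p, hp⟩ := hex
    have hle := Finset.single_le_sum (fun p _ => hd0 p) (Finset.mem_univ p)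
    have := hd p
    exact S.eq_zero_of_mem (D.degree k r d a ha) (by omega) (by omega)
  · have hz : ∑ p, d p = 0 := Finset.sum_eq_zero fun p _ => not_not.1 fun hp => hex ⟨p, hp⟩
    have hk' := h.resolve_left hex
    exact S.eq_zero_of_mem (D.degree k r d a ha) (by omega) (by omega)

theorem mu_eq_zero (hn : 2 ≤ n) (D : DendInfStr 𝒜) (h1 : D.mu 1 = 0) (k : ℕ) (hk2 : k ≠ 2)
    (hkn : k ≠ n + 1) : D.mu k = 0 := by
  obtain rfl | hk1 := eq_or_ne k 1
  · exact h1
  ext1 r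
  -- Rules out `k = 0`, where there is no operation.
  have := r.pos
  exact S.multilinear_ext fun d a hd ha =>
    S.mu_apply_eq_zero hn D (by omega) r d a hd ha (Or.inr hkn)

theorem mu_two_u_u (D : DendInfStr 𝒜) (r : Fin 2) (a b : A) :
    D.mu 2 r ![S.u a, S.u b] ∈ 𝒜 0 := by
  have h := D.degree 2 r ![0, 0] ![S.u a, S.u b] (fun p => by fin_cases p <;> simp [S.u_mem])
  simpa using h

theorem mu_two_u_v (D : DendInfStr 𝒜) (r : Fin 2) (a : A) (m : M) :
    D.mu 2 r ![S.u a, S.v m] ∈ 𝒜 ((n : ℤ) - 1) := by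
  have h := D.degree 2 r ![0, (n : ℤ) - 1] ![S.u a, S.v m]
    (fun p => by fin_cases p <;> simp [S.u_mem, S.v_mem])
  simpa using h

theorem mu_two_v_u (D : DendInfStr 𝒜) (r : Fin 2) (m : M) (a : A) :
    D.mu 2 r ![S.v m, S.u a] ∈ 𝒜 ((n : ℤ) - 1) := by
  have h := D.degree 2 r ![(n : ℤ) - 1, 0] ![S.v m, S.u a]
    (fun p => by fin_cases p <;> simp [S.u_mem, S.v_mem])
  simpa using h

/-- The value would have degree `2(n - 1)`, which differs from `0` and `n - 1` because `n ≥ 2`. -/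
theorem mu_two_v_v (hn : 2 ≤ n) (D : DendInfStr 𝒜) (r : Fin 2) (m m' : M) :
    D.mu 2 r ![S.v m, S.v m'] = 0 := by
  have h := D.degree 2 r ![(n : ℤ) - 1, (n : ℤ) - 1] ![S.v m, S.v m']
    (fun p => by fin_cases p <;> simp [S.v_mem])
  simp only [Fin.sum_univ_two, Matrix.cons_val_zero, Matrix.cons_val_one] at h
  exact S.eq_zero_of_mem h (by push_cast; omega) (by push_cast; omega)

theorem mu_u (D : DendInfStr 𝒜) (r : Fin (n + 1)) (a : Fin (n + 1) → A) :
    D.mu (n + 1) r (fun p => S.u (a p)) ∈ 𝒜 ((n : ℤ) - 1) := by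
  have h := D.degree (n + 1) r 0 (fun p => S.u (a p)) (fun p => S.u_mem _)
  have e : ∑ p : Fin (n + 1), (0 : Fin (n + 1) → ℤ) p + (((n + 1 : ℕ) : ℤ) - 2) = (n : ℤ) - 1 := by
    simp only [Pi.zero_apply, Finset.sum_const_zero]
    push_cast
    ring
  rwa [e] at h

/-- A `Dend_∞`-structure with zero differential is determined by its tuple. -/
theorem eq_of_corresponds (hn : 2 ≤ n) {D D' : DendInfStr 𝒜} (h : D.mu 1 = 0) (h' : D'.mu 1 = 0)
    {T : DendCocycleTuple K A M n} (hD : DendCorresponds S.u S.v D T)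
    (hD' : DendCorresponds S.u S.v D' T) : D = D' := by
  suffices hmu : D.mu = D'.mu by
    cases D; cases D'; cases hmu; rfl
  ext1 k
  by_cases hk2 : k = 2
  · subst hk2
    ext1 r
    have hB : (D.mu 2 r).toBilin = (D'.mu 2 r).toBilin := by
      ext x y
      rw [← S.decomp x, ← S.decomp y]
      simp only [map_add, LinearMap.add_apply, MultilinearMap.toBilin_apply, ← hD.pi_eq,
        ← hD'.pi_eq, ← hD.theta1_eq, ← hD'.theta1_eq, ← hD.theta2_eq, ← hD'.theta2_eq,
        S.mu_two_v_v hn]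
    ext x
    have hx : x = ![x 0, x 1] := by ext p; fin_cases p <;> rfl
    rw [hx]
    exact LinearMap.congr_fun₂ hB (x 0) (x 1)
  by_cases hkn : k = n + 1
  · subst hkn
    ext1 r
    refine S.multilinear_ext fun d a hd ha => ?_
    by_cases hex : ∃ p, d p ≠ 0
    · rw [S.mu_apply_eq_zero hn D (by omega) r d a hd ha (Or.inl hex),
        S.mu_apply_eq_zero hn D' (by omega) r d a hd ha (Or.inl hex)]
    · push Not at hex
      have hau : a = fun p => S.u (S.p (a p)) :=
        funext fun p => (S.u_p_of_mem (hex p ▸ ha p)).symm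
      rw [hau, ← hD.sigma_eq, ← hD'.sigma_eq]
  · rw [S.mu_eq_zero hn D h k hk2 hkn, S.mu_eq_zero hn D' h' k hk2 hkn]

theorem tuple_eq_of_corresponds {D : DendInfStr 𝒜} {T T' : DendCocycleTuple K A M n}
    (hT : DendCorresponds S.u S.v D T) (hT' : DendCorresponds S.u S.v D T') : T = T' := by
  obtain ⟨T, R, f, hf⟩ := T
  obtain ⟨T', R', f', hf'⟩ := T'
  obtain rfl : T = T' := DendriformStr.ext_pi <| by
    ext r a b
    exact S.u_injective ((hT.pi_eq r a b).trans (hT'.pi_eq r a b).symm)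
  obtain rfl : R = R' := DendriformRep.ext_theta
    (by
      ext r a m
      exact S.v_injective ((hT.theta1_eq r a m).trans (hT'.theta1_eq r a m).symm))
    (by
      ext r m a
      exact S.v_injective ((hT.theta2_eq r m a).trans (hT'.theta2_eq r m a).symm))
  obtain rfl : f = f' := by
    ext r a
    exact S.v_injective ((hT.sigma_eq r a).trans (hT'.sigma_eq r a).symm)
  rfl

end TwoDegreeSplitting

/-! ### From `Dend_∞` structures to tuples -/

section Dendriform

variable {K : Type*} [Field K] {V : Type*} [AddCommGroup V] [Module K V]

/-- The three identities with three inputs are the dendriform identities. -/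
theorem forall_insert_two_two_eq_zero_iff
    (mu : (k : ℕ) → Fin k → MultilinearMap K (fun _ : Fin k => V) V) (d : Fin 3 → ℤ) (a : Fin 3 → V) :
    (∀ r, dendInfInsert mu (i := 2) (j := 2) rfl r d a = 0) ↔
      mu 2 0 ![mu 2 0 ![a 0, a 1], a 2] =
        mu 2 0 ![a 0, mu 2 0 ![a 1, a 2]] + mu 2 0 ![a 0, mu 2 1 ![a 1, a 2]] ∧
      mu 2 0 ![mu 2 1 ![a 0, a 1], a 2] = mu 2 1 ![a 0, mu 2 0 ![a 1, a 2]] ∧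
      mu 2 1 ![mu 2 0 ![a 0, a 1], a 2] + mu 2 1 ![mu 2 1 ![a 0, a 1], a 2] =
        mu 2 1 ![a 0, mu 2 1 ![a 1, a 2]] := by
  have add_left : ∀ r x y z, mu 2 r ![x + y, z] = mu 2 r ![x, z] + mu 2 r ![y, z] :=
    fun r x y z => (mu 2 r).toBilin.map_add₂ x y z
  have add_right : ∀ r x y z, mu 2 r ![x, y + z] = mu 2 r ![x, y] + mu 2 r ![x, z] :=
    fun r x y z => ((mu 2 r).toBilin x).map_add y z
  simp only [dendInfInsert_two_two, sub_eq_zero, Fin.forall_fin_succ,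
    IsEmpty.forall_iff, and_true]
  simp only [Matrix.cons_val_zero, Matrix.cons_val_succ, dendLin_single, dendLin_one_two,
    add_apply, add_left, add_right]
  rw [eq_comm, and_congr_right_iff]
  intro _
  rw [eq_comm, and_congr_right_iff]
  intro _
  rw [eq_comm]

/-- The degrees are arbitrary, so this one statement supplies the axioms on `A` and, with one
argument in `M`, all nine representation axioms. -/
theorem DendInfStr.identity_three {𝒜 : ℤ → Submodule K V} (D : DendInfStr 𝒜) (h : D.mu 1 = 0) {d e f : ℤ}
    {x y z : V} (hx : x ∈ 𝒜 d) (hy : y ∈ 𝒜 e) (hz : z ∈ 𝒜 f) :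
    D.mu 2 0 ![D.mu 2 0 ![x, y], z] =
      D.mu 2 0 ![x, D.mu 2 0 ![y, z]] + D.mu 2 0 ![x, D.mu 2 1 ![y, z]] ∧
    D.mu 2 0 ![D.mu 2 1 ![x, y], z] = D.mu 2 1 ![x, D.mu 2 0 ![y, z]] ∧
    D.mu 2 1 ![D.mu 2 0 ![x, y], z] + D.mu 2 1 ![D.mu 2 1 ![x, y], z] =
      D.mu 2 1 ![x, D.mu 2 1 ![y, z]] := by
  refine (forall_insert_two_two_eq_zero_iff D.mu ![d, e, f] ![x, y, z]).1 fun r => ?_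
  rw [← dendInf_sum_three _ h, ← dendInf_sum_eq]
  exact D.identity 3 r _ _ fun p => by fin_cases p <;> assumption

end Dendriform

namespace TwoDegreeSplitting

variable {K : Type*} [Field K] {V : Type*} [AddCommGroup V] [Module K V]
  {𝒜 : ℤ → Submodule K V} {A M : Type*} [AddCommGroup A] [Module K A]
  [AddCommGroup M] [Module K M] {n : ℕ} (S : TwoDegreeSplitting 𝒜 A M n)

/-- The restriction of `μ_2` to `A ⊗ A → A`. -/
def restrictPi (D : DendInfStr 𝒜) (r : Fin 2) : A →ₗ[K] A →ₗ[K] A :=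
  ((D.mu 2 r).toBilin.compl₁₂ S.u S.u).compr₂ S.p

/-- The restriction of `μ_2` to `A ⊗ M → M`. -/
def restrictTheta1 (D : DendInfStr 𝒜) (r : Fin 2) : A →ₗ[K] M →ₗ[K] M :=
  ((D.mu 2 r).toBilin.compl₁₂ S.u S.v).compr₂ S.q

/-- The restriction of `μ_2` to `M ⊗ A → M`. -/
def restrictTheta2 (D : DendInfStr 𝒜) (r : Fin 2) : M →ₗ[K] A →ₗ[K] M :=
  ((D.mu 2 r).toBilin.compl₁₂ S.v S.u).compr₂ S.q

/-- The restriction of `μ_{n+1}` to `A ⊗ ⋯ ⊗ A → M`. -/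
def restrictSigma (D : DendInfStr 𝒜) : DendCochain K A M (n + 1) := fun r =>
  S.q.compMultilinearMap ((D.mu (n + 1) r).compLinearMap fun _ => S.u)

theorem u_restrictPi (D : DendInfStr 𝒜) (r : Fin 2) (a b : A) :
    S.u (S.restrictPi D r a b) = D.mu 2 r ![S.u a, S.u b] :=
  S.u_p_of_mem (S.mu_two_u_u D r a b)

theorem v_restrictTheta1 (D : DendInfStr 𝒜) (r : Fin 2) (a : A) (m : M) :
    S.v (S.restrictTheta1 D r a m) = D.mu 2 r ![S.u a, S.v m] :=
  S.v_q_of_mem (S.mu_two_u_v D r a m)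

theorem v_restrictTheta2 (D : DendInfStr 𝒜) (r : Fin 2) (m : M) (a : A) :
    S.v (S.restrictTheta2 D r m a) = D.mu 2 r ![S.v m, S.u a] :=
  S.v_q_of_mem (S.mu_two_v_u D r m a)

theorem v_restrictSigma (D : DendInfStr 𝒜) (r : Fin (n + 1)) (a : Fin (n + 1) → A) :
    S.v (S.restrictSigma D r a) = D.mu (n + 1) r (fun p => S.u (a p)) :=
  S.v_q_of_mem (S.mu_u D r a)

/-- The dendriform algebra in degree `0` of a `Dend_∞`-algebra with zero differential. -/
def restrictStr (D : DendInfStr 𝒜) (h : D.mu 1 = 0) : DendriformStr K A where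
  prec := S.restrictPi D 0
  succ := S.restrictPi D 1
  ax1 a b c := S.u_injective <| by
    simpa only [u_restrictPi, map_add,
      LinearMap.add_apply] using
      (D.identity_three h (S.u_mem a) (S.u_mem b) (S.u_mem c)).1
  ax2 a b c := S.u_injective <| by
    simpa only [u_restrictPi, map_add,
      LinearMap.add_apply] using
      (D.identity_three h (S.u_mem a) (S.u_mem b) (S.u_mem c)).2.1
  ax3 a b c := S.u_injective <| by
    simpa only [u_restrictPi, map_add,
      LinearMap.add_apply] using
      (D.identity_three h (S.u_mem a) (S.u_mem b) (S.u_mem c)).2.2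

/-- The representation in degree `n - 1` of a `Dend_∞`-algebra with zero differential. -/
def restrictRep (D : DendInfStr 𝒜) (h : D.mu 1 = 0) : DendriformRep (S.restrictStr D h) M where
  lprec := S.restrictTheta1 D 0
  lsucc := S.restrictTheta1 D 1
  rprec := S.restrictTheta2 D 0
  rsucc := S.restrictTheta2 D 1
  left1 a b c := S.v_injective <| by
    simpa only [restrictStr, u_restrictPi, v_restrictTheta1, map_add,
      LinearMap.add_apply] using
      (D.identity_three h (S.u_mem a) (S.u_mem b) (S.v_mem c)).1
  left2 a b c := S.v_injective <| by
    simpa only [restrictStr, u_restrictPi, v_restrictTheta1, map_add,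
      LinearMap.add_apply] using
      (D.identity_three h (S.u_mem a) (S.u_mem b) (S.v_mem c)).2.1
  left3 a b c := S.v_injective <| by
    simpa only [restrictStr, u_restrictPi, v_restrictTheta1, map_add,
      LinearMap.add_apply] using
      (D.identity_three h (S.u_mem a) (S.u_mem b) (S.v_mem c)).2.2
  mid1 a b c := S.v_injective <| by
    simpa only [v_restrictTheta2, v_restrictTheta1, map_add,
      LinearMap.add_apply] using
      (D.identity_three h (S.u_mem a) (S.v_mem b) (S.u_mem c)).1
  mid2 a b c := S.v_injective <| by
    simpa only [v_restrictTheta2, v_restrictTheta1, map_add,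
      LinearMap.add_apply] using
      (D.identity_three h (S.u_mem a) (S.v_mem b) (S.u_mem c)).2.1
  mid3 a b c := S.v_injective <| by
    simpa only [v_restrictTheta2, v_restrictTheta1, map_add,
      LinearMap.add_apply] using
      (D.identity_three h (S.u_mem a) (S.v_mem b) (S.u_mem c)).2.2
  right1 a b c := S.v_injective <| by
    simpa only [restrictStr, u_restrictPi, v_restrictTheta2, map_add,
      LinearMap.add_apply] using
      (D.identity_three h (S.v_mem a) (S.u_mem b) (S.u_mem c)).1
  right2 a b c := S.v_injective <| by
    simpa only [restrictStr, u_restrictPi, v_restrictTheta2, map_add,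
      LinearMap.add_apply] using
      (D.identity_three h (S.v_mem a) (S.u_mem b) (S.u_mem c)).2.1
  right3 a b c := S.v_injective <| by
    simpa only [restrictStr, u_restrictPi, v_restrictTheta2, map_add,
      LinearMap.add_apply] using
      (D.identity_three h (S.v_mem a) (S.u_mem b) (S.u_mem c)).2.2

theorem restrictStr_pi (D : DendInfStr 𝒜) (h : D.mu 1 = 0) :
    (S.restrictStr D h).pi = S.restrictPi D := by
  ext1 r; fin_cases r <;> rfl

theorem restrictRep_theta1 (D : DendInfStr 𝒜) (h : D.mu 1 = 0) :
    (S.restrictRep D h).theta1 = S.restrictTheta1 D := by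
  ext1 r; fin_cases r <;> rfl

theorem restrictRep_theta2 (D : DendInfStr 𝒜) (h : D.mu 1 = 0) :
    (S.restrictRep D h).theta2 = S.restrictTheta2 D := by
  ext1 r; fin_cases r <;> rfl

/-- The injection of `M` into `V` carries the coboundary to the identity with `n + 2` inputs of
degree `0`. -/
theorem restrictSigma_isCocycle (hn : 2 ≤ n) (D : DendInfStr 𝒜) (h : D.mu 1 = 0) :
    IsDendCocycle (S.restrictRep D h) (S.restrictSigma D) := by
  intro r a
  refine S.v_injective ?_
  rw [map_zero, ← S.insert_add_insert_eq_dendDelta D.mu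
    (hpi := fun r a b => by rw [restrictStr_pi, u_restrictPi])
    (h1 := fun r a b => by rw [restrictRep_theta1, v_restrictTheta1])
    (h2 := fun r a b => by rw [restrictRep_theta2, v_restrictTheta2])
    (hf := fun r a => (S.v_restrictSigma D r a).symm),
    ← dendInf_sum_add_two _ hn (S.mu_eq_zero hn D h), ← dendInf_sum_eq]
  exact D.identity (n + 2) r 0 _ fun p => S.u_mem _

/-- The tuple of restrictions of a `Dend_∞`-algebra structure with zero differential. -/
def restrict (hn : 2 ≤ n) (D : DendInfZeroDiff 𝒜) : DendCocycleTuple K A M n where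
  str := S.restrictStr D.1 D.2
  rep := S.restrictRep D.1 D.2
  sigma := S.restrictSigma D.1
  cocycle := S.restrictSigma_isCocycle hn D.1 D.2

theorem restrict_corresponds (hn : 2 ≤ n) (D : DendInfZeroDiff 𝒜) :
    DendCorresponds S.u S.v D.1 (S.restrict hn D) where
  pi_eq r a b := by rw [restrict, restrictStr_pi, u_restrictPi]
  theta1_eq r a m := by rw [restrict, restrictRep_theta1, v_restrictTheta1]
  theta2_eq r m a := by rw [restrict, restrictRep_theta2, v_restrictTheta2]
  sigma_eq r a := S.v_restrictSigma D.1 r a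

end TwoDegreeSplitting

/-! ### From tuples to `Dend_∞` structures -/

theorem dendOuter_of_lt {X : Type*} {i j N : ℕ} (h : i + j = N + 1) (l : Fin j) (a : Fin N → X)
    (y : X) (t : Fin N) (ht : t.val < l.val) : dendOuter h l a y ⟨t.val, by omega⟩ = a t := by
  simp [dendOuter, ht]

theorem dendOuter_of_le {X : Type*} {i j N : ℕ} (h : i + j = N + 1) (l : Fin j) (a : Fin N → X)
    (y : X) (t : Fin N) (hi : 0 < i) (ht : l.val + i ≤ t.val) :
    dendOuter h l a y ⟨t.val + 1 - i, by omega⟩ = a t := by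
  have h1 : ¬ t.val + 1 - i < l.val := by omega
  have h2 : ¬ t.val + 1 - i = l.val := by omega
  simp only [dendOuter, h1, h2, dif_neg, not_false_eq_true]
  congr 1
  ext
  simp only
  omega

/-- With the two preceding lemmas this locates each original input among the inner or outer ones, so
that an input from `M` can be traced through a composite. -/
theorem dendInner_of_mem {X : Type*} {i j N : ℕ} (h : i + j = N + 1) (l : Fin j) (a : Fin N → X)
    (t : Fin N) (h1 : l.val ≤ t.val) (h2 : t.val < l.val + i) :
    dendInner h l a ⟨t.val - l.val, by omega⟩ = a t := by
  simp [dendInner, Nat.add_sub_cancel' h1]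

namespace TwoDegreeSplitting

variable {K : Type*} [Field K] {V : Type*} [AddCommGroup V] [Module K V]
  {𝒜 : ℤ → Submodule K V} {A M : Type*} [AddCommGroup A] [Module K A]
  [AddCommGroup M] [Module K M] {n : ℕ} (S : TwoDegreeSplitting 𝒜 A M n)

theorem p_eq_zero_of_mem {x : V} {d : ℤ} (hx : x ∈ 𝒜 d) (hd : d ≠ 0) : S.p x = 0 := by
  by_cases h : d = (n : ℤ) - 1
  · exact S.p_eq_zero x (h ▸ hx)
  · rw [S.eq_zero_of_mem hx hd h, map_zero]

theorem q_eq_zero_of_mem {x : V} {d : ℤ} (hx : x ∈ 𝒜 d) (hd : d ≠ (n : ℤ) - 1) : S.q x = 0 := by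
  by_cases h : d = 0
  · exact S.q_eq_zero x (h ▸ hx)
  · rw [S.eq_zero_of_mem hx h hd, map_zero]

/-- The product on `A ⊕ M` given by a multiplication on `A` and its actions on `M`. -/
def extendTwo (T : DendCocycleTuple K A M n) (r : Fin 2) :
    MultilinearMap K (fun _ : Fin 2 => V) V :=
  (((T.str.pi r).compl₁₂ S.p S.p).compr₂ S.u +
    (((T.rep.theta1 r).compl₁₂ S.p S.q).compr₂ S.v +
      ((T.rep.theta2 r).compl₁₂ S.q S.p).compr₂ S.v)).toMultilinearTwo

/-- The extension of a cochain by zero. -/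
def extendSigma (T : DendCocycleTuple K A M n) (r : Fin (n + 1)) :
    MultilinearMap K (fun _ : Fin (n + 1) => V) V :=
  S.v.compMultilinearMap ((T.sigma r).compLinearMap fun _ => S.p)

/-- The operations of the `Dend_∞`-algebra of a tuple. -/
def extendMu (T : DendCocycleTuple K A M n) (k : ℕ) :
    Fin k → MultilinearMap K (fun _ : Fin k => V) V :=
  if h2 : k = 2 then h2 ▸ S.extendTwo T
  else if hn : k = n + 1 then hn ▸ S.extendSigma T
  else 0

variable (T : DendCocycleTuple K A M n)

theorem extendMu_succ (hn : 2 ≤ n) : S.extendMu T (n + 1) = S.extendSigma T := by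
  have h : ¬ n + 1 = 2 := by omega
  simp [extendMu, h]

theorem extendMu_of_ne {k : ℕ} (h2 : k ≠ 2) (hn : k ≠ n + 1) : S.extendMu T k = 0 := by
  simp [extendMu, h2, hn]

theorem extendMu_two_apply (r : Fin 2) (x : Fin 2 → V) :
    S.extendMu T 2 r x = S.u (T.str.pi r (S.p (x 0)) (S.p (x 1))) +
      (S.v (T.rep.theta1 r (S.p (x 0)) (S.q (x 1))) +
        S.v (T.rep.theta2 r (S.q (x 0)) (S.p (x 1)))) := rfl

theorem extendMu_succ_apply (hn : 2 ≤ n) (r : Fin (n + 1)) (x : Fin (n + 1) → V) :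
    S.extendMu T (n + 1) r x = S.v (T.sigma r fun t => S.p (x t)) := by
  rw [extendMu_succ S T hn]
  rfl

theorem p_extendMu_two (r : Fin 2) (x : Fin 2 → V) :
    S.p (S.extendMu T 2 r x) = T.str.pi r (S.p (x 0)) (S.p (x 1)) := by
  simp [extendMu_two_apply, S.p_u, S.p_v]

theorem q_extendMu_two (r : Fin 2) (x : Fin 2 → V) :
    S.q (S.extendMu T 2 r x) = T.rep.theta1 r (S.p (x 0)) (S.q (x 1)) +
      T.rep.theta2 r (S.q (x 0)) (S.p (x 1)) := by
  simp [extendMu_two_apply, S.q_u, S.q_v]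

theorem extendMu_two_eq_zero (r : Fin 2) {x : Fin 2 → V} (hx : ∀ t, S.p (x t) = 0) :
    S.extendMu T 2 r x = 0 := by
  simp [extendMu_two_apply, hx]

theorem extendMu_succ_eq_zero (hn : 2 ≤ n) (r : Fin (n + 1)) {x : Fin (n + 1) → V}
    {t : Fin (n + 1)} (ht : S.p (x t) = 0) : S.extendMu T (n + 1) r x = 0 := by
  rw [S.extendMu_succ_apply T hn, (T.sigma r).map_coord_zero t ht, map_zero]

/-- `M` is an ideal for the extended products. -/
theorem p_dendLin_extendMu_two (c : Fin 2 → K) {x : Fin 2 → V} {t : Fin 2} (ht : S.p (x t) = 0) :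
    S.p (dendLin (S.extendMu T 2) c x) = 0 := by
  simp only [dendLin_apply, map_sum, map_smul, p_extendMu_two]
  refine Finset.sum_eq_zero fun r _ => ?_
  fin_cases t
  · rw [show S.p (x 0) = 0 from ht]; simp
  · rw [show S.p (x 1) = 0 from ht]; simp

theorem p_dendLin_extendMu_succ (hn : 2 ≤ n) (c : Fin (n + 1) → K) (x : Fin (n + 1) → V) :
    S.p (dendLin (S.extendMu T (n + 1)) c x) = 0 := by
  simp [dendLin_apply, S.extendMu_succ_apply T hn, S.p_v]

theorem dendLin_extendMu_succ_eq_zero (hn : 2 ≤ n) (c : Fin (n + 1) → K) {x : Fin (n + 1) → V}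
    {t : Fin (n + 1)} (ht : S.p (x t) = 0) : dendLin (S.extendMu T (n + 1)) c x = 0 := by
  simp [dendLin_apply, S.extendMu_succ_eq_zero T hn _ ht]

/-- `A ⊕ M` is the split extension with `M · M = 0`. The `A`-component of each identity is an axiom
of `A`; the `M`-component is the sum of three representation axioms, one for each position of the
argument from `M`. -/
theorem insert_two_two_extendMu (r : Fin 3) (d : Fin 3 → ℤ) (a : Fin 3 → V) :
    dendInfInsert (S.extendMu T) (i := 2) (j := 2) rfl r d a = 0 := by
  refine (forall_insert_two_two_eq_zero_iff (S.extendMu T) d a).2 ⟨?_, ?_, ?_⟩ r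
  · apply S.ext_p_q
    · have := T.str.ax1 (S.p (a 0)) (S.p (a 1)) (S.p (a 2))
      simpa [p_extendMu_two, DendriformStr.pi] using this
    · have h1 := T.rep.left1 (S.p (a 0)) (S.p (a 1)) (S.q (a 2))
      have h2 := T.rep.mid1 (S.p (a 0)) (S.q (a 1)) (S.p (a 2))
      have h3 := T.rep.right1 (S.q (a 0)) (S.p (a 1)) (S.p (a 2))
      simp only [map_add] at h1 h2 h3
      simp only [p_extendMu_two, q_extendMu_two, DendriformStr.pi, DendriformRep.theta1,
        DendriformRep.theta2, Matrix.cons_val_zero, Matrix.cons_val_one, map_add,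
        LinearMap.add_apply, h1, h2, h3]
      abel
  · apply S.ext_p_q
    · have := T.str.ax2 (S.p (a 0)) (S.p (a 1)) (S.p (a 2))
      simpa [p_extendMu_two, DendriformStr.pi] using this
    · have h1 := T.rep.left2 (S.p (a 0)) (S.p (a 1)) (S.q (a 2))
      have h2 := T.rep.mid2 (S.p (a 0)) (S.q (a 1)) (S.p (a 2))
      have h3 := T.rep.right2 (S.q (a 0)) (S.p (a 1)) (S.p (a 2))
      simp only [p_extendMu_two, q_extendMu_two, DendriformStr.pi, DendriformRep.theta1,
        DendriformRep.theta2, Matrix.cons_val_zero, Matrix.cons_val_one, map_add,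
        LinearMap.add_apply, h1, h2, h3]
      abel
  · apply S.ext_p_q
    · have := T.str.ax3 (S.p (a 0)) (S.p (a 1)) (S.p (a 2))
      simpa [p_extendMu_two, DendriformStr.pi] using this
    · have h1 := T.rep.left3 (S.p (a 0)) (S.p (a 1)) (S.q (a 2))
      have h2 := T.rep.mid3 (S.p (a 0)) (S.q (a 1)) (S.p (a 2))
      have h3 := T.rep.right3 (S.q (a 0)) (S.p (a 1)) (S.p (a 2))
      simp only [map_add, LinearMap.add_apply] at h1 h2 h3
      simp only [p_extendMu_two, q_extendMu_two, DendriformStr.pi, DendriformRep.theta1,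
        DendriformRep.theta2, Matrix.cons_val_zero, Matrix.cons_val_one, map_add,
        LinearMap.add_apply, ← h1, ← h2, ← h3]
      abel

/-- The input from `M` either remains an argument of `σ` or enters the product, whose value then
lies in `M`; in both cases `σ` vanishes. -/
theorem insert_two_extendMu_eq_zero (hn : 2 ≤ n) (h : 2 + (n + 1) = n + 2 + 1) (r : Fin (n + 2))
    (d : Fin (n + 2) → ℤ) {a : Fin (n + 2) → V} {t : Fin (n + 2)} (ht : S.p (a t) = 0) :
    dendInfInsert (S.extendMu T) h r d a = 0 := by
  refine Finset.sum_eq_zero fun l _ => ?_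
  rw [smul_eq_zero]
  right
  rcases lt_or_ge t.val l.val with h1 | h1
  · exact S.extendMu_succ_eq_zero T hn _ (t := ⟨t.val, by omega⟩)
      (by rwa [dendOuter_of_lt h l a _ t h1])
  rcases lt_or_ge t.val (l.val + 2) with h2 | h2
  · refine S.extendMu_succ_eq_zero T hn _ (t := l) ?_
    rw [dendOuter_self]
    exact S.p_dendLin_extendMu_two T _ (t := ⟨t.val - l.val, by omega⟩)
      (by rwa [dendInner_of_mem h l a t h1 h2])
  · exact S.extendMu_succ_eq_zero T hn _ (t := ⟨t.val + 1 - 2, by omega⟩)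
      (by rwa [dendOuter_of_le h l a _ t two_pos h2])

theorem insert_succ_extendMu_eq_zero (hn : 2 ≤ n) (h : n + 1 + 2 = n + 2 + 1) (r : Fin (n + 2))
    (d : Fin (n + 2) → ℤ) {a : Fin (n + 2) → V} {t : Fin (n + 2)} (ht : S.p (a t) = 0) :
    dendInfInsert (S.extendMu T) h r d a = 0 := by
  refine Finset.sum_eq_zero fun l _ => ?_
  rw [smul_eq_zero]
  right
  by_cases hin : l.val ≤ t.val ∧ t.val < l.val + (n + 1)
  · refine MultilinearMap.map_coord_zero _ l ?_
    rw [dendOuter_self]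
    exact S.dendLin_extendMu_succ_eq_zero T hn _ (t := ⟨t.val - l.val, by omega⟩)
      (by rwa [dendInner_of_mem h l a t hin.1 hin.2])
  -- The input outside the block is the other factor of the outer product, so both factors lie in
  -- `M`: one by assumption, one as a value of `σ`.
  · refine S.extendMu_two_eq_zero T _ fun s => ?_
    simp only [dendOuter]
    split_ifs with h1 h2
    · rwa [show (⟨s.val, _⟩ : Fin (n + 2)) = t from Fin.ext (by simp only; omega)]
    · exact S.p_dendLin_extendMu_succ T hn _ _
    · rwa [show (⟨s.val + (n + 1) - 1, _⟩ : Fin (n + 2)) = t from Fin.ext (by simp only; omega)]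

theorem insert_succ_succ_extendMu (hn : 2 ≤ n) {N : ℕ} (h : n + 1 + (n + 1) = N + 1) (r : Fin N)
    (d : Fin N → ℤ) (a : Fin N → V) : dendInfInsert (S.extendMu T) h r d a = 0 := by
  refine Finset.sum_eq_zero fun l _ => ?_
  rw [smul_eq_zero]
  right
  refine S.extendMu_succ_eq_zero T hn _ (t := l) ?_
  rw [dendOuter_self]
  exact S.p_dendLin_extendMu_succ T hn _ _

theorem extendMu_mem (hn : 2 ≤ n) (k : ℕ) (r : Fin k) (d : Fin k → ℤ) (a : Fin k → V)
    (ha : ∀ p, a p ∈ 𝒜 (d p)) : S.extendMu T k r a ∈ 𝒜 ((∑ p, d p) + ((k : ℤ) - 2)) := by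
  by_cases hk2 : k = 2
  · subst hk2
    have hn0 : (0 : ℤ) ≠ (n : ℤ) - 1 := by omega
    rw [Fin.sum_univ_two, Nat.cast_ofNat, sub_self, add_zero, extendMu_two_apply]
    by_cases h0 : d 0 = 0 <;> by_cases h1 : d 1 = 0
    · rw [S.q_eq_zero_of_mem (ha 0) (h0 ▸ hn0), S.q_eq_zero_of_mem (ha 1) (h1 ▸ hn0), h0, h1]
      simpa using S.u_mem _
    · rw [S.q_eq_zero_of_mem (ha 0) (h0 ▸ hn0), S.p_eq_zero_of_mem (ha 1) h1, h0]
      by_cases h : d 1 = (n : ℤ) - 1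
      · simpa [h] using S.v_mem _
      · simp [S.q_eq_zero_of_mem (ha 1) h]
    · rw [S.q_eq_zero_of_mem (ha 1) (h1 ▸ hn0), S.p_eq_zero_of_mem (ha 0) h0, h1]
      by_cases h : d 0 = (n : ℤ) - 1
      · simpa [h] using S.v_mem _
      · simp [S.q_eq_zero_of_mem (ha 0) h]
    · simp [S.p_eq_zero_of_mem (ha 0) h0, S.p_eq_zero_of_mem (ha 1) h1]
  by_cases hkn : k = n + 1
  · subst hkn
    by_cases hd : ∃ p, d p ≠ 0
    · obtain ⟨p, hp⟩ := hd
      rw [S.extendMu_succ_eq_zero T hn r (S.p_eq_zero_of_mem (ha p) hp)]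
      exact zero_mem _
    · push Not at hd
      have e : ∑ p, d p + (((n + 1 : ℕ) : ℤ) - 2) = (n : ℤ) - 1 := by
        simp only [hd, Finset.sum_const_zero]
        push_cast
        ring
      rw [e, S.extendMu_succ_apply T hn]
      exact S.v_mem _
  · rw [S.extendMu_of_ne T hk2 hkn]
    exact zero_mem _

theorem extendMu_identity (hn : 2 ≤ n) (N : ℕ) (r : Fin N) (d : Fin N → ℤ) (a : Fin N → V)
    (ha : ∀ p, a p ∈ 𝒜 (d p)) :
    ∑ s : Fin N, dendInfInsert (S.extendMu T) (dendArity s) r d a = 0 := by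
  by_cases hN3 : N = 3
  · subst hN3
    rw [dendInf_sum_three _ (S.extendMu_of_ne T (by omega) (by omega)), insert_two_two_extendMu]
  by_cases hNn : N = n + 2
  · subst hNn
    rw [dendInf_sum_add_two _ hn fun k => S.extendMu_of_ne T]
    by_cases hd : ∃ p, d p ≠ 0
    · obtain ⟨p, hp⟩ := hd
      have hp' := S.p_eq_zero_of_mem (ha p) hp
      rw [S.insert_two_extendMu_eq_zero T hn _ r d hp',
        S.insert_succ_extendMu_eq_zero T hn _ r d hp', add_zero]
    · push Not at hd
      obtain rfl : d = 0 := funext hd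
      have hau : a = fun p => S.u (S.p (a p)) := funext fun p => (S.u_p_of_mem (ha p)).symm
      rw [hau, S.insert_add_insert_eq_dendDelta (S.extendMu T) T.rep T.sigma, T.cocycle, map_zero]
      · intro r a b
        simp [extendMu_two_apply, S.p_u, S.q_u]
      · intro r a m
        simp [extendMu_two_apply, S.p_u, S.q_u, S.p_v, S.q_v]
      · intro r m a
        simp [extendMu_two_apply, S.p_u, S.q_u, S.p_v, S.q_v]
      · intro r a
        simp [S.extendMu_succ_apply T hn, S.p_u]
  · refine Finset.sum_eq_zero fun s _ => ?_
    by_cases hi : s.val + 1 = 2 ∨ s.val + 1 = n + 1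
    · by_cases hj : N - s.val = 2 ∨ N - s.val = n + 1
      -- With `N ≠ 3` and `N ≠ n + 2`, two surviving arities must both be `n + 1`.
      · rw [dendInfInsert_congr (S.extendMu T) (dendArity s)
          (show n + 1 + (n + 1) = N + 1 by omega) (by omega)]
        exact S.insert_succ_succ_extendMu T hn _ r d a
      · push Not at hj
        exact dendInfInsert_eq_zero_of_outer _ _ (S.extendMu_of_ne T hj.1 hj.2) _ _ _
    · push Not at hi
      exact dendInfInsert_eq_zero_of_inner _ _ (S.extendMu_of_ne T hi.1 hi.2) _ _ _

/-- The `Dend_∞`-algebra structure with zero differential of a tuple. -/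
def extend (hn : 2 ≤ n) : DendInfZeroDiff 𝒜 where
  val :=
    { mu := S.extendMu T
      degree := S.extendMu_mem T hn
      identity := fun N r d a ha => by
        rw [dendInf_sum_eq]
        exact S.extendMu_identity T hn N r d a ha }
  property := S.extendMu_of_ne T (k := 1) (by omega) (by omega)

theorem extend_corresponds (hn : 2 ≤ n) : DendCorresponds S.u S.v (S.extend T hn).1 T where
  pi_eq r a b := by simp [extend, extendMu_two_apply, S.p_u, S.q_u]
  theta1_eq r a m := by simp [extend, extendMu_two_apply, S.p_u, S.q_u, S.p_v, S.q_v]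
  theta2_eq r m a := by simp [extend, extendMu_two_apply, S.p_u, S.q_u, S.p_v, S.q_v]
  sigma_eq r a := by simp [extend, S.extendMu_succ_apply T hn, S.p_u]

/-- `Dend_∞`-algebra structures with zero differential correspond to tuples. -/
def dendInfEquiv (hn : 2 ≤ n) : DendInfZeroDiff 𝒜 ≃ DendCocycleTuple K A M n where
  toFun := S.restrict hn
  invFun T := S.extend T hn
  -- Each inverse law is a uniqueness statement: the two objects compared correspond to a common
  -- tuple, respectively to a common structure.
  left_inv D := Subtype.ext <| S.eq_of_corresponds hn (S.extend _ hn).2 D.2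
    (S.extend_corresponds _ hn) (S.restrict_corresponds hn D)
  right_inv T := S.tuple_eq_of_corresponds (S.restrict_corresponds hn _)
    (S.extend_corresponds T hn)

/-- The splitting of an internally graded vector space. -/
noncomputable def ofIsCompl (hc : IsCompl (𝒜 0) (𝒜 ((n : ℤ) - 1))) (h : ConcentratedZeroAnd 𝒜 n) :
    TwoDegreeSplitting 𝒜 (𝒜 0) (𝒜 ((n : ℤ) - 1)) n where
  u := (𝒜 0).subtype
  v := (𝒜 ((n : ℤ) - 1)).subtype
  p := Submodule.projectionOnto _ _ hc
  q := Submodule.projectionOnto _ _ hc.symm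
  p_u := Submodule.projectionOnto_apply_left hc
  p_v := Submodule.projectionOnto_apply_right hc
  q_u := Submodule.projectionOnto_apply_right hc.symm
  q_v := Submodule.projectionOnto_apply_left hc.symm
  decomp x := by
    obtain ⟨y, z, rfl, -⟩ := Submodule.existsUnique_add_of_isCompl hc x
    simp only [map_add, Submodule.projectionOnto_apply_left, Submodule.projectionOnto_apply_right,
      Submodule.subtype_apply, add_zero, zero_add]
  u_mem a := a.2
  v_mem m := m.2
  q_eq_zero x hx := Submodule.projectionOnto_apply_right hc.symm ⟨x, hx⟩
  p_eq_zero x hx := Submodule.projectionOnto_apply_right hc ⟨x, hx⟩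
  concentrated := h

end TwoDegreeSplitting

/-! ### Gradings concentrated in two degrees -/

section Grading

variable {K : Type*} [Field K] {n : ℕ}

theorem ConcentratedZeroAnd.isCompl {V : Type*} [AddCommGroup V] [Module K V]
    {𝒜 : ℤ → Submodule K V} (h : ConcentratedZeroAnd 𝒜 n) (hn : 2 ≤ n)
    (hi : DirectSum.IsInternal 𝒜) : IsCompl (𝒜 0) (𝒜 ((n : ℤ) - 1)) := by
  refine ⟨hi.submodule_iSupIndep.pairwiseDisjoint (by omega), codisjoint_iff_le_sup.2 ?_⟩
  rw [← hi.submodule_iSup_eq_top]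
  refine iSup_le fun d => ?_
  by_cases h0 : d = 0
  · exact h0 ▸ le_sup_left
  by_cases h1 : d = (n : ℤ) - 1
  · exact h1 ▸ le_sup_right
  · rw [h d h0 h1]
    exact bot_le

/-- All other pieces are zero, so the supremum of the pieces different from a given one is contained
in its complement. -/
theorem ConcentratedZeroAnd.isInternal {V : Type*} [AddCommGroup V] [Module K V]
    {𝒜 : ℤ → Submodule K V} (h : ConcentratedZeroAnd 𝒜 n)
    (hc : IsCompl (𝒜 0) (𝒜 ((n : ℤ) - 1))) : DirectSum.IsInternal 𝒜 := by
  refine DirectSum.isInternal_submodule_of_iSupIndep_of_iSup_eq_top (fun d => ?_) ?_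
  · by_cases h0 : d = 0
    · subst h0
      refine hc.disjoint.mono_right (iSup₂_le fun e he => ?_)
      by_cases h1 : e = (n : ℤ) - 1
      · rw [h1]
      · rw [h e he h1]
        exact bot_le
    by_cases h1 : d = (n : ℤ) - 1
    · subst h1
      refine hc.symm.disjoint.mono_right (iSup₂_le fun e he => ?_)
      by_cases h0 : e = 0
      · rw [h0]
      · rw [h e h0 he]
        exact bot_le
    · rw [h d h0 h1]
      exact disjoint_bot_left
  · rw [eq_top_iff, ← hc.sup_eq_top]
    exact sup_le (le_iSup 𝒜 _) (le_iSup 𝒜 _)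

variable (K) (A M : Type*) [AddCommGroup A] [Module K A] [AddCommGroup M] [Module K M]

theorem zeroAndGrading_concentrated : ConcentratedZeroAnd (zeroAndGrading K A M n) n := by
  intro d h0 h1
  simp [zeroAndGrading, h0, h1]

theorem mem_zeroAndGrading_zero (hn : 2 ≤ n) (x : A × M) :
    x ∈ zeroAndGrading K A M n 0 ↔ x.2 = 0 := by
  have h : (0 : ℤ) ≠ (n : ℤ) - 1 := by omega
  simp [zeroAndGrading, h, Submodule.mem_prod]

theorem mem_zeroAndGrading_sub_one (hn : 2 ≤ n) (x : A × M) :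
    x ∈ zeroAndGrading K A M n ((n : ℤ) - 1) ↔ x.1 = 0 := by
  have h : (n : ℤ) - 1 ≠ 0 := by omega
  simp [zeroAndGrading, h, Submodule.mem_prod]

theorem isInternal_zeroAndGrading (hn : 2 ≤ n) :
    DirectSum.IsInternal (zeroAndGrading K A M n) := by
  refine (zeroAndGrading_concentrated K A M).isInternal ⟨?_, ?_⟩
  · rw [Submodule.disjoint_def]
    intro x h2 h1
    rw [mem_zeroAndGrading_zero K A M hn] at h2
    rw [mem_zeroAndGrading_sub_one K A M hn] at h1
    exact Prod.ext h1 h2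
  · rw [codisjoint_iff_le_sup]
    intro x _
    refine Submodule.mem_sup.2 ⟨(x.1, 0), ?_, (0, x.2), ?_, by simp⟩
    · rw [mem_zeroAndGrading_zero K A M hn]
    · rw [mem_zeroAndGrading_sub_one K A M hn]

/-- The splitting of `A ⊕ M`. -/
def zeroAndSplitting (hn : 2 ≤ n) : TwoDegreeSplitting (zeroAndGrading K A M n) A M n where
  u := LinearMap.inl K A M
  v := LinearMap.inr K A M
  p := LinearMap.fst K A M
  q := LinearMap.snd K A M
  p_u _ := rfl
  p_v _ := rfl
  q_u _ := rfl
  q_v _ := rfl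
  decomp x := by simp
  u_mem a := (mem_zeroAndGrading_zero K A M hn _).2 rfl
  v_mem m := (mem_zeroAndGrading_sub_one K A M hn _).2 rfl
  q_eq_zero x := (mem_zeroAndGrading_zero K A M hn x).1
  p_eq_zero x := (mem_zeroAndGrading_sub_one K A M hn x).1
  concentrated := zeroAndGrading_concentrated K A M

end Grading

theorem theorem6p3 (K : Type*) [Field K] [CharZero K] (n : ℕ) (hn : 2 ≤ n) :
    (∀ (V : Type*) [AddCommGroup V] [Module K V] (𝒜 : ℤ → Submodule K V),
      DirectSum.IsInternal 𝒜 → ConcentratedZeroAnd 𝒜 n →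
      ∃ Φ : DendInfZeroDiff 𝒜 ≃ DendCocycleTuple K (𝒜 0) (𝒜 ((n : ℤ) - 1)) n,
        ∀ D, DendCorresponds (𝒜 0).subtype (𝒜 ((n : ℤ) - 1)).subtype D.1 (Φ D)) ∧
    (∀ (A M : Type*) [AddCommGroup A] [Module K A] [AddCommGroup M] [Module K M],
      DirectSum.IsInternal (zeroAndGrading K A M n) ∧
      ConcentratedZeroAnd (zeroAndGrading K A M n) n ∧
      ∃ Φ : DendInfZeroDiff (zeroAndGrading K A M n) ≃ DendCocycleTuple K A M n,
        ∀ D, DendCorresponds (LinearMap.inl K A M) (LinearMap.inr K A M) D.1 (Φ D)) := by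
  refine ⟨fun V _ _ 𝒜 hi hc => ?_, fun A M _ _ _ _ => ⟨isInternal_zeroAndGrading K A M hn,
    zeroAndGrading_concentrated K A M, (zeroAndSplitting K A M hn).dendInfEquiv hn,
    (zeroAndSplitting K A M hn).restrict_corresponds hn⟩⟩
  let S := TwoDegreeSplitting.ofIsCompl (hc.isCompl hn hi) hc
  exact ⟨S.dendInfEquiv hn, S.restrict_corresponds hn⟩
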